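/- Let $\mathbb K\in\{\mathbb R,\mathbb C\}$ and let $X$ be a Banach space over $\mathbb K$ that fails the approximation property, i.e. it is not true that for every compact $K\subset X$ and every $\varepsilon>0$ there is a bounded finite rank operator $T$ on $X$ with $\sup_{x\in K}\|x-Tx\|\le\varepsilon$. For a sequence $x=(x_n)$ in $X$ write $\Gamma(x)=\overline{\mathrm{conv}}\{c\,x_n : n\in\mathbb N,\ c\in\mathbb K,\ |c|=1\}$ (so $\Gamma(x)=\overline{\mathrm{conv}}\{\pm x_n: n\in\mathbb N\}$ for real scalars). Call $x$ admissible if $0<\|x_n\|\le 1$ for all $n$, $\|x_n\|\to0$, and there is $c>0$ such that $\sup_{y\in\Gamma(x)}\|y-Vy\|\ge c$ for every bounded finite rank operator $V$ on $X$. Given an admissible sequence $x$ and $t\in(0,1)$, let $U_t=\Gamma\big((x_n/\|x_n\|^{t})_n\big)$, let $Y_t$ be the linear span of $U_t$ in $X$, and let $|y|_t=\inf\{\lambda>0: y\in\lambda U_t\}$ for $y\in Y_t$. Let $\mathcal Z$ be the linear span of the functions $y\chi_{(s,t)}$ on $(0,1)$ with $0<s<t<1$ and $y\in Y_s$, with $$\|f\|=\int_0^1|f(r)|_r\,dr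 ,\qquad f\in\mathcal Z$$ (functions that agree almost everywhere are identified), and let the Willis space $Z=Z_X$ be the completion of $(\mathcal Z,\|\cdot\|)$. Let $\mathcal K(Z)$ be the space of compact operators on $Z$ with the operator norm, let $\mathcal A(Z)$ be the norm closure of the bounded finite rank operators on $Z$, and give $\mathcal K(Z)/\mathcal A(Z)$ the quotient norm. Then admissible sequences in $X$ exist, and for every admissible sequence there is a linear isomorphic embedding $\psi:c_0\to\mathcal K(Z)/\mathcal A(Z)$, that is, a bounded linear map for which there is $\delta>0$ with $\|\psi(a)\|\ge\delta\|a\|$ for all $a\in c_0$. -/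

import Mathlib

open Set Filter Topology MeasureTheory
open scoped Pointwise ZeroAtInfty

section Operators

variable (𝕜 : Type*) [RCLike 𝕜]

/-- The linear space `F(X)` of bounded finite rank operators on `X`. -/
def finiteRankOperators (X : Type*) [NormedAddCommGroup X] [NormedSpace 𝕜 X] :
    Submodule 𝕜 (X →L[𝕜] X) where
  carrier := {T | FiniteDimensional 𝕜 (LinearMap.range (T : X →ₗ[𝕜] X))}
  add_mem' {S T} hS hT := by
    have hS' : FiniteDimensional 𝕜 (LinearMap.range (S : X →ₗ[𝕜] X)) := hS
    have hT' : FiniteDimensional 𝕜 (LinearMap.range (T : X →ₗ[𝕜] X)) := hT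
    refine Submodule.finiteDimensional_of_le
      (S₂ := LinearMap.range (S : X →ₗ[𝕜] X) ⊔ LinearMap.range (T : X →ₗ[𝕜] X)) ?_
    rintro _ ⟨x, rfl⟩
    exact Submodule.add_mem_sup ⟨x, rfl⟩ ⟨x, rfl⟩
  zero_mem' := by
    refine Submodule.finiteDimensional_of_le (S₂ := (⊥ : Submodule 𝕜 X)) ?_
    rintro _ ⟨x, rfl⟩
    simp
  smul_mem' c T hT := by
    have hT' : FiniteDimensional 𝕜 (LinearMap.range (T : X →ₗ[𝕜] X)) := hT
    refine Submodule.finiteDimensional_of_le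
      (S₂ := LinearMap.range (T : X →ₗ[𝕜] X)) ?_
    rintro _ ⟨x, rfl⟩
    exact Submodule.smul_mem _ c ⟨x, rfl⟩

/-- The approximation property. -/
def HasApproximationProperty (X : Type*) [NormedAddCommGroup X] [NormedSpace 𝕜 X] : Prop :=
  ∀ K : Set X, IsCompact K → ∀ ε : ℝ, 0 < ε →
    ∃ T ∈ finiteRankOperators 𝕜 X, ∀ x ∈ K, ‖x - T x‖ ≤ ε

/-- The Banach space `K(X)` of compact operators on `X`, with the operator norm. -/
abbrev CompactOperators (X : Type*) [NormedAddCommGroup X] [NormedSpace 𝕜 X] :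
    Submodule 𝕜 (X →L[𝕜] X) :=
  compactOperator (RingHom.id 𝕜) X X

/-- The space `A(X)` of approximable operators: the norm closure of `F(X)`. -/
def approximableOperators (X : Type*) [NormedAddCommGroup X] [NormedSpace 𝕜 X] :
    Submodule 𝕜 (X →L[𝕜] X) :=
  (finiteRankOperators 𝕜 X).topologicalClosure

/-- The subspace `A(X)` of `K(X)`. -/
def approximableInCompact (X : Type*) [NormedAddCommGroup X] [NormedSpace 𝕜 X] :
    Submodule 𝕜 (CompactOperators 𝕜 X) :=
  (approximableOperators 𝕜 X).comap (CompactOperators 𝕜 X).subtype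

instance isClosed_approximableInCompact (X : Type*) [NormedAddCommGroup X] [NormedSpace 𝕜 X] :
    IsClosed (approximableInCompact 𝕜 X : Set (CompactOperators 𝕜 X)) :=
  (Submodule.isClosed_topologicalClosure (finiteRankOperators 𝕜 X)).preimage
    continuous_subtype_val

/-- The quotient `K(X) / A(X)`. -/
def CompactByApproximable (X : Type*) [NormedAddCommGroup X] [NormedSpace 𝕜 X] : Type _ :=
  CompactOperators 𝕜 X ⧸ approximableInCompact 𝕜 X

/-- The quotient norm `‖T + A(X)‖ = inf {‖T - S‖ : S ∈ A(X)}`. -/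
noncomputable instance (X : Type*) [NormedAddCommGroup X] [NormedSpace 𝕜 X] :
    NormedAddCommGroup (CompactByApproximable 𝕜 X) :=
  inferInstanceAs (NormedAddCommGroup (CompactOperators 𝕜 X ⧸ approximableInCompact 𝕜 X))

noncomputable instance (X : Type*) [NormedAddCommGroup X] [NormedSpace 𝕜 X] :
    NormedSpace 𝕜 (CompactByApproximable 𝕜 X) :=
  inferInstanceAs (NormedSpace 𝕜 (CompactOperators 𝕜 X ⧸ approximableInCompact 𝕜 X))

end Operators

section Gauge

variable {𝕜 X : Type*} [RCLike 𝕜] [NormedAddCommGroup X] [NormedSpace 𝕜 X]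
  [NormedSpace ℝ X]

/-- The closed convex hull of `{c x_n : n ∈ ℕ, |c| = 1}`; over the reals this is the closed
convex hull of `{± x_n : n ∈ ℕ}`. -/
def closedCircledHull (𝕜 : Type*) {X : Type*} [RCLike 𝕜] [NormedAddCommGroup X]
    [NormedSpace 𝕜 X] [NormedSpace ℝ X] (x : ℕ → X) : Set X :=
  closure (convexHull ℝ {z | ∃ (n : ℕ) (c : 𝕜), ‖c‖ = 1 ∧ z = c • x n})

theorem mem_closedCircledHull (x : ℕ → X) (n : ℕ) : x n ∈ closedCircledHull 𝕜 x :=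
  subset_closure (subset_convexHull ℝ _ ⟨n, 1, by simp, by simp⟩)

theorem convex_closedCircledHull (x : ℕ → X) : Convex ℝ (closedCircledHull 𝕜 x) :=
  (convex_convexHull ℝ _).closure

variable [IsScalarTower ℝ 𝕜 X]

theorem balanced_closedCircledHull (x : ℕ → X) : Balanced 𝕜 (closedCircledHull 𝕜 x) := by
  set S : Set X := {z | ∃ (n : ℕ) (c : 𝕜), ‖c‖ = 1 ∧ z = c • x n} with hS
  have h0 : (0 : X) ∈ convexHull ℝ S := by
    have h1 : x 0 ∈ convexHull ℝ S := subset_convexHull ℝ _ ⟨0, 1, by simp, by simp⟩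
    have h2 : -x 0 ∈ convexHull ℝ S := subset_convexHull ℝ _ ⟨0, -1, by simp, by simp⟩
    have h3 := convex_convexHull ℝ S h1 h2 (a := 1 / 2) (b := 1 / 2)
      (by norm_num) (by norm_num) (by norm_num)
    simpa using h3
  have hunit : ∀ u : 𝕜, ‖u‖ = 1 → ∀ z ∈ convexHull ℝ S, u • z ∈ convexHull ℝ S := by
    intro u hu z hz
    let L : X →ₗ[ℝ] X :=
      { toFun := fun y => u • y
        map_add' := fun a b => smul_add u a b
        map_smul' := fun r y => by
          simp only [RingHom.id_apply]
          rw [← algebraMap_smul 𝕜 r y, ← algebraMap_smul 𝕜 r (u • y), smul_comm] }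
    have hsub : L '' S ⊆ S := by
      rintro _ ⟨_, ⟨n, c, hc, rfl⟩, rfl⟩
      exact ⟨n, u * c, by simp [hu, hc], by simp [L, mul_smul]⟩
    have h1 : L z ∈ convexHull ℝ (L '' S) := by
      rw [← L.image_convexHull]
      exact ⟨z, hz, rfl⟩
    exact convexHull_mono hsub h1
  refine Balanced.closure (balanced_iff_smul_mem.2 ?_)
  intro a ha z hz
  by_cases ha0 : a = 0
  · simpa [ha0] using h0
  have hna : (0 : ℝ) < ‖a‖ := norm_pos_iff.2 ha0
  have h1 : ((‖a‖⁻¹ : ℝ) : 𝕜) • a • z ∈ convexHull ℝ S := by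
    rw [smul_smul]
    refine hunit _ ?_ z hz
    rw [norm_mul, RCLike.norm_ofReal, abs_of_pos (inv_pos.2 hna), inv_mul_cancel₀ hna.ne']
  have h2 := (convex_convexHull ℝ S).smul_mem_of_zero_mem h0 h1 ⟨hna.le, ha⟩
  have h3 : ‖a‖ • ((‖a‖⁻¹ : ℝ) : 𝕜) • a • z = a • z := by
    rw [← algebraMap_smul 𝕜 ‖a‖, smul_smul, RCLike.algebraMap_eq_ofReal, ← RCLike.ofReal_mul,
      mul_inv_cancel₀ hna.ne', RCLike.ofReal_one, one_smul]
  rwa [h3] at h2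

/-- On the linear span of a nonempty balanced convex set the Minkowski functional is finite. -/
theorem exists_mem_smul_of_mem_span {U : Set X} (hc : Convex ℝ U) (hb : Balanced 𝕜 U)
    (hne : U.Nonempty) {y : X} (hy : y ∈ Submodule.span 𝕜 U) :
    ∃ r : ℝ, 0 < r ∧ y ∈ r • U := by
  have h0 : (0 : X) ∈ U := hb.zero_mem hne
  induction hy using Submodule.span_induction with
  | mem z hz => exact ⟨1, one_pos, by simpa using hz⟩
  | zero => exact ⟨1, one_pos, by simpa using h0⟩
  | add a b _ _ iha ihb =>
    obtain ⟨r, hr, ha⟩ := iha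
    obtain ⟨q, hq, hb'⟩ := ihb
    exact ⟨r + q, by positivity, by
      rw [hc.add_smul hr.le hq.le]
      exact Set.add_mem_add ha hb'⟩
  | smul c a _ iha =>
    obtain ⟨r, hr, z, hz, rfl⟩ := iha
    refine ⟨r * (‖c‖ + 1), by positivity, (((‖c‖ + 1)⁻¹ : ℝ) : 𝕜) • c • z, ?_, ?_⟩
    · rw [smul_smul]
      refine hb.smul_mem ?_ hz
      rw [norm_mul, RCLike.norm_ofReal, abs_of_pos (by positivity), inv_mul_le_one₀ (by positivity)]
      linarith
    · have hpos : (‖c‖ + 1 : ℝ) ≠ 0 := by positivity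
      change (r * (‖c‖ + 1)) • (((‖c‖ + 1)⁻¹ : ℝ) : 𝕜) • c • z = c • r • z
      rw [← algebraMap_smul 𝕜 (r * (‖c‖ + 1)), ← algebraMap_smul 𝕜 r, smul_smul, smul_comm c,
        RCLike.algebraMap_eq_ofReal, ← RCLike.ofReal_mul, mul_assoc, mul_inv_cancel₀ hpos, mul_one]

theorem gauge_add_le_of_mem_span {U : Set X} (hc : Convex ℝ U) (hb : Balanced 𝕜 U)
    (hne : U.Nonempty) {y z : X} (hy : y ∈ Submodule.span 𝕜 U) (hz : z ∈ Submodule.span 𝕜 U) :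
    gauge U (y + z) ≤ gauge U y + gauge U z := by
  refine le_of_forall_pos_lt_add fun ε hε => ?_
  obtain ⟨r, ⟨hr, hyr⟩, hr'⟩ := exists_lt_of_csInf_lt
    (show {r ∈ Ioi (0 : ℝ) | y ∈ r • U}.Nonempty from exists_mem_smul_of_mem_span hc hb hne hy)
    (show gauge U y < gauge U y + ε / 2 by linarith)
  obtain ⟨q, ⟨hq, hzq⟩, hq'⟩ := exists_lt_of_csInf_lt
    (show {r ∈ Ioi (0 : ℝ) | z ∈ r • U}.Nonempty from exists_mem_smul_of_mem_span hc hb hne hz)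
    (show gauge U z < gauge U z + ε / 2 by linarith)
  have hr0 : 0 ≤ r := le_of_lt hr
  have hq0 : 0 ≤ q := le_of_lt hq
  have h : gauge U (y + z) ≤ r + q := by
    refine gauge_le_of_mem (add_nonneg hr0 hq0) ?_
    rw [hc.add_smul hr0 hq0]
    exact Set.add_mem_add hyr hzq
  linarith

end Gauge

/-- The data on which the construction of the Willis space rests: a null sequence of nonzero
vectors in the unit ball of `X` such that on the set `K`, the closed convex hull of
`{c x_n : n ∈ ℕ, |c| = 1}`, the identity of `X` is not a uniform limit of finite rank
operators. -/
structure WillisSequence (𝕜 X : Type*) [RCLike 𝕜] [NormedAddCommGroup X] [NormedSpace 𝕜 X]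
    [NormedSpace ℝ X] where
  x : ℕ → X
  norm_pos : ∀ n, 0 < ‖x n‖
  norm_le_one : ∀ n, ‖x n‖ ≤ 1
  tendsto_norm : Tendsto (fun n => ‖x n‖) atTop (𝓝 0)
  fails : ∃ c : ℝ, 0 < c ∧ ∀ V ∈ finiteRankOperators 𝕜 X,
    ∃ y ∈ closedCircledHull 𝕜 x, c ≤ ‖y - V y‖

namespace WillisSequence

variable {𝕜 X : Type*} [RCLike 𝕜] [NormedAddCommGroup X] [NormedSpace 𝕜 X]
  [NormedSpace ℝ X] (w : WillisSequence 𝕜 X)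

/-- The set `U_t`: the closed convex hull of the vectors `c x_n / ‖x_n‖ ^ t` with `|c| = 1`. -/
def U (t : ℝ) : Set X := closedCircledHull 𝕜 fun n => (‖w.x n‖ ^ t)⁻¹ • w.x n

/-- The space `Y_t`: the linear span of `U_t` in `X`. -/
def Y (t : ℝ) : Submodule 𝕜 X := Submodule.span 𝕜 (w.U t)

/-- The norm `|·|_t` of `Y_t`: the Minkowski functional of `U_t`. -/
noncomputable def normY (t : ℝ) (y : X) : ℝ := gauge (w.U t) y

/-- The linear span of the functions `y χ_(s,t)` with `0 < s < t < 1` and `y ∈ Y_s`. -/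
def simpleFunctions : Submodule 𝕜 (ℝ → X) :=
  Submodule.span 𝕜 {f | ∃ s t : ℝ, 0 < s ∧ s < t ∧ t < 1 ∧
    ∃ y ∈ w.Y s, f = (Ioo s t).indicator fun _ => y}

/-- The space of simple functions as a type of its own: it is not to carry the topology of
pointwise convergence. -/
def Simple : Type _ := w.simpleFunctions

instance : AddCommGroup w.Simple := inferInstanceAs (AddCommGroup w.simpleFunctions)

instance : Module 𝕜 w.Simple := inferInstanceAs (Module 𝕜 w.simpleFunctions)

/-- The simple function, extended by zero outside `(0, 1)`, that an element of `w.Simple` is. -/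
def eval (f : w.Simple) : ℝ → X := (show w.simpleFunctions from f).1

theorem convex_U (t : ℝ) : Convex ℝ (w.U t) := convex_closedCircledHull _

theorem nonempty_U (t : ℝ) : (w.U t).Nonempty := ⟨_, mem_closedCircledHull _ 0⟩

section

variable [IsScalarTower ℝ 𝕜 X]

theorem balanced_U (t : ℝ) : Balanced 𝕜 (w.U t) := balanced_closedCircledHull _

theorem U_mono {s t : ℝ} (hst : s ≤ t) : w.U s ⊆ w.U t := by
  refine closure_minimal (convexHull_min ?_ (w.convex_U t)) isClosed_closure
  rintro _ ⟨n, c, hc, rfl⟩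
  refine (w.balanced_U t).smul_mem hc.le ?_
  have hp := w.norm_pos n
  have h1 : (‖w.x n‖ ^ s)⁻¹ = ‖w.x n‖ ^ (t - s) * (‖w.x n‖ ^ t)⁻¹ := by
    rw [← Real.rpow_neg hp.le, ← Real.rpow_neg hp.le, ← Real.rpow_add hp]
    congr 1
    ring
  have h2 : ‖w.x n‖ ^ (t - s) ≤ 1 :=
    Real.rpow_le_one hp.le (w.norm_le_one n) (sub_nonneg.2 hst)
  change (‖w.x n‖ ^ s)⁻¹ • w.x n ∈ w.U t
  rw [h1, mul_smul]
  exact (w.convex_U t).smul_mem_of_zero_mem ((w.balanced_U t).zero_mem (w.nonempty_U t))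
    (mem_closedCircledHull _ n) ⟨by positivity, h2⟩

theorem Y_mono {s t : ℝ} (hst : s ≤ t) : w.Y s ≤ w.Y t := Submodule.span_mono (w.U_mono hst)

theorem normY_anti {s t : ℝ} (hst : s ≤ t) {y : X} (hy : y ∈ w.Y s) :
    w.normY t y ≤ w.normY s y :=
  csInf_le_csInf ⟨0, fun _ h => le_of_lt h.1⟩
    (exists_mem_smul_of_mem_span (w.convex_U s) (w.balanced_U s) (w.nonempty_U s) hy)
    fun _ h => ⟨h.1, smul_set_mono (w.U_mono hst) h.2⟩

theorem normY_add_le {t : ℝ} {y z : X} (hy : y ∈ w.Y t) (hz : z ∈ w.Y t) :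
    w.normY t (y + z) ≤ w.normY t y + w.normY t z :=
  gauge_add_le_of_mem_span (w.convex_U t) (w.balanced_U t) (w.nonempty_U t) hy hz

theorem normY_smul (t : ℝ) (c : 𝕜) (y : X) : w.normY t (c • y) = ‖c‖ * w.normY t y :=
  gauge_smul (w.balanced_U t) c y

/-- A simple function takes values in the spaces `Y_r`, with uniformly bounded norms. -/
theorem simple_bounded (f : w.Simple) :
    ∃ C : ℝ, ∀ r, w.eval f r ∈ w.Y r ∧ w.normY r (w.eval f r) ≤ C := by
  obtain ⟨f, hf⟩ := f
  change ∃ C : ℝ, ∀ r, f r ∈ w.Y r ∧ w.normY r (f r) ≤ C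
  have h0 : ∀ r, w.normY r 0 = 0 := fun r => gauge_zero
  induction hf using Submodule.span_induction with
  | mem f hf =>
    obtain ⟨s, t, -, -, -, y, hy, rfl⟩ := hf
    refine ⟨w.normY s y, fun r => ?_⟩
    by_cases hr : r ∈ Ioo s t
    · rw [indicator_of_mem hr]
      exact ⟨w.Y_mono hr.1.le hy, w.normY_anti hr.1.le hy⟩
    · rw [indicator_of_notMem hr]
      exact ⟨zero_mem _, (h0 r).le.trans (gauge_nonneg _)⟩
  | zero => exact ⟨0, fun r => ⟨zero_mem _, (h0 r).le⟩⟩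
  | add f g _ _ hf hg =>
    obtain ⟨C, hC⟩ := hf
    obtain ⟨D, hD⟩ := hg
    exact ⟨C + D, fun r => ⟨add_mem (hC r).1 (hD r).1,
      (w.normY_add_le (hC r).1 (hD r).1).trans (add_le_add (hC r).2 (hD r).2)⟩⟩
  | smul c f _ hf =>
    obtain ⟨C, hC⟩ := hf
    refine ⟨‖c‖ * C, fun r => ⟨Submodule.smul_mem _ c (hC r).1, ?_⟩⟩
    rw [Pi.smul_apply, w.normY_smul]
    exact mul_le_mul_of_nonneg_left (hC r).2 (norm_nonneg c)

/-- The function `r ↦ |f(r)|_r` is integrable on `(0, 1)`. -/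
theorem simple_integrable (f : w.Simple) :
    IntegrableOn (fun r => w.normY r (w.eval f r)) (Ioo 0 1) := by
  obtain ⟨C, hC⟩ := w.simple_bounded f
  have hφ : ∃ φ : SimpleFunc ℝ X, ⇑φ = w.eval f := by
    obtain ⟨f, hf⟩ := f
    change ∃ φ : SimpleFunc ℝ X, ⇑φ = f
    clear hC
    induction hf using Submodule.span_induction with
    | mem f hf =>
      obtain ⟨s, t, -, -, -, y, -, rfl⟩ := hf
      classical
      refine ⟨SimpleFunc.piecewise (Ioo s t) measurableSet_Ioo (SimpleFunc.const ℝ y)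
        (SimpleFunc.const ℝ 0), ?_⟩
      ext r
      by_cases hr : r ∈ Ioo s t <;> simp [hr]
    | zero => exact ⟨0, rfl⟩
    | add f g _ _ hf hg =>
      obtain ⟨φ, rfl⟩ := hf
      obtain ⟨ψ, rfl⟩ := hg
      exact ⟨φ + ψ, rfl⟩
    | smul c f _ hf =>
      obtain ⟨φ, rfl⟩ := hf
      exact ⟨c • φ, rfl⟩
  obtain ⟨φ, hφ⟩ := hφ
  have hm : AEMeasurable (fun r => w.normY r (w.eval f r)) volume := by
    have hU : (⋃ v : φ.range, φ ⁻¹' {(v : X)}) = univ := by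
      ext r
      simp
    rw [← Measure.restrict_univ (μ := (volume : Measure ℝ)), ← hU, aemeasurable_iUnion_iff]
    intro v
    have hms : MeasurableSet (φ ⁻¹' {(v : X)}) := φ.measurableSet_fiber v
    refine aemeasurable_restrict_of_antitoneOn hms ?_
    intro a ha b hb hab
    have ha' : w.eval f a = v := by rw [← hφ]; exact ha
    have hb' : w.eval f b = v := by rw [← hφ]; exact hb
    change w.normY b (w.eval f b) ≤ w.normY a (w.eval f a)
    rw [ha', hb']
    exact w.normY_anti hab (ha' ▸ (hC a).1)
  refine IntegrableOn.of_bound (by simp) hm.aestronglyMeasurable.restrict C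
    (Eventually.of_forall fun r => ?_)
  exact (Real.norm_of_nonneg (gauge_nonneg _)).trans_le (hC r).2

/-- The seminorm `‖f‖ = ∫_0^1 |f(r)|_r dr` on the simple functions. -/
noncomputable def simpleSeminorm : Seminorm 𝕜 w.Simple :=
  Seminorm.of (fun f => ∫ r in Ioo (0 : ℝ) 1, w.normY r (w.eval f r))
    (fun f g => by
      rw [← integral_add (w.simple_integrable f) (w.simple_integrable g)]
      refine integral_mono (w.simple_integrable (f + g))
        ((w.simple_integrable f).add (w.simple_integrable g)) fun r => ?_
      obtain ⟨C, hC⟩ := w.simple_bounded f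
      obtain ⟨D, hD⟩ := w.simple_bounded g
      exact w.normY_add_le (hC r).1 (hD r).1)
    (fun c f => by
      rw [← integral_const_mul]
      exact integral_congr_ae (Eventually.of_forall fun r => w.normY_smul r c (w.eval f r)))

noncomputable instance : SeminormedAddCommGroup w.Simple :=
  w.simpleSeminorm.toAddGroupSeminorm.toSeminormedAddCommGroup

theorem norm_simple (f : w.Simple) : ‖f‖ = ∫ r in Ioo (0 : ℝ) 1, w.normY r (w.eval f r) := rfl

noncomputable instance : NormedSpace 𝕜 w.Simple where
  norm_smul_le c f := (map_smul_eq_mul w.simpleSeminorm c f).le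

/-- The Willis space: the (Hausdorff) completion of the space of simple functions. Simple
functions that agree almost everywhere are identified in it. -/
def Space : Type _ := UniformSpace.Completion w.Simple

noncomputable instance : NormedAddCommGroup w.Space :=
  inferInstanceAs (NormedAddCommGroup (UniformSpace.Completion w.Simple))

noncomputable instance : NormedSpace 𝕜 w.Space :=
  inferInstanceAs (NormedSpace 𝕜 (UniformSpace.Completion w.Simple))

instance : CompleteSpace w.Space :=
  inferInstanceAs (CompleteSpace (UniformSpace.Completion w.Simple))

end

end WillisSequence

/-!
Every compact set lies in the closed convex hull of a null sequence (Grothendieck), so failure of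
the approximation property is witnessed by an admissible sequence. For the Willis space, let `T_n`
integrate over the `n`-th of infinitely many disjoint intervals `(s_n, t_n)` below `1 / 2` and
spread the result over `(1 / 2, 3 / 4)`. It is compact, because `U_s` is compact in `Y_t` for
`s < t`, and since the norm of `Z` is an `L¹`-norm, `‖∑ a_n T_n‖ ≤ sup |a_n|`. Integrating once
more over `(1 / 2, 3 / 4)` turns `∑ a_n T_n` on functions `y χ_(s_m, t_m)`, `y ∈ Y_{s_m}`, into a
multiple of `a_m` times the inclusion `Y_{s_m} → X`. A finite rank operator close to `∑ a_n T_n`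
would hence give one `Y_{s_m} → X` close to this inclusion; by compactness of `U_0` in `Y_{s_m}`
and the Hahn–Banach theorem it would be approximated uniformly on `U_0` by one that is defined on
`X`, which admissibility forbids unless `a_m` is small.
-/

section NullSequence

variable {X : Type*} [NormedAddCommGroup X]

theorem exists_tendsto_zero_iUnion_subset_range {F : ℕ → Set X} (hfinite : ∀ n, (F n).Finite)
    (hsmall : Tendsto F atTop (𝓝 0).smallSets) :
    ∃ u : ℕ → X, Tendsto u atTop (𝓝 0) ∧ ⋃ n, F n ⊆ range u := by
  obtain ⟨f, hf⟩ :=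
    (countable_iUnion fun n => (hfinite n).countable).to_subtype.exists_injective_nat
  refine ⟨Function.extend f Subtype.val 0, ?_, fun d hd => ⟨f ⟨d, hd⟩, hf.extend_apply _ _ _⟩⟩
  rw [← Nat.cofinite_eq_atTop]
  intro s hs
  obtain ⟨N, hN⟩ := eventually_atTop.1 (tendsto_smallSets_iff.1 hsmall s hs)
  have hlarge : ((⋃ n, F n) \ s).Finite := by
    refine ((finite_lt_nat N).biUnion fun n _ => hfinite n).subset fun d ⟨hd, hds⟩ => ?_
    obtain ⟨n, hdn⟩ := mem_iUnion.1 hd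
    exact mem_biUnion (not_le.1 fun hn => hds (hN n hn hdn)) hdn
  refine ((hlarge.preimage Subtype.val_injective.injOn).image f).subset fun n hn => ?_
  by_cases h : ∃ d, f d = n
  · obtain ⟨d, rfl⟩ := h
    exact ⟨d, ⟨d.2, by simpa [hf.extend_apply] using hn⟩, rfl⟩
  · exact absurd (mem_of_mem_nhds hs) (by simpa [Function.extend_apply' _ _ _ h] using hn)

variable [NormedSpace ℝ X]

theorem infDist_midpoint_le_of_mem {C : Set X} (hC : Convex ℝ C) {f : X} (hf : f ∈ C) (k : X) :
    Metric.infDist (midpoint ℝ f k) C ≤ 1 / 2 * Metric.infDist k C := by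
  refine le_of_forall_gt_imp_ge_of_dense fun r hr => ?_
  obtain ⟨c, hc, hkc⟩ := (Metric.infDist_lt_iff ⟨f, hf⟩).1
    (show Metric.infDist k C < 2 * r by linarith)
  calc Metric.infDist (midpoint ℝ f k) C
      ≤ dist (midpoint ℝ f k) (midpoint ℝ f c) :=
        Metric.infDist_le_dist_of_mem (hC.midpoint_mem hf hc)
    _ ≤ (dist f f + dist k c) / 2 := by
        simpa using dist_midpoint_midpoint_le f k f c
    _ ≤ r := by rw [dist_self]; linarith

theorem exists_finite_subset_midpoint {K : Set X} (hK : IsCompact K) {r : ℝ} (hr : 0 < r) :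
    ∃ F K' : Set X, F.Finite ∧ F ⊆ (2 : ℝ) • K ∧ IsCompact K' ∧ K' ⊆ Metric.closedBall 0 r ∧
      ∀ x ∈ K, ∃ f ∈ F, ∃ k ∈ K', x = midpoint ℝ f k := by
  obtain ⟨N, hNK, hN, hcover⟩ := hK.finite_cover_balls (half_pos hr)
  have hdiff : IsCompact (K - N) := by
    rw [sub_eq_add_neg]
    exact hK.add hN.isCompact.neg
  refine ⟨(2 : ℝ) • N, (2 : ℝ) • (K - N) ∩ Metric.closedBall 0 r, hN.smul_set,
    smul_set_mono hNK, (hdiff.smul _).inter_right Metric.isClosed_closedBall,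
    inter_subset_right, fun x hx => ?_⟩
  obtain ⟨y, hy, hxy⟩ := mem_iUnion₂.1 (hcover hx)
  rw [mem_ball_iff_norm] at hxy
  refine ⟨(2 : ℝ) • y, smul_mem_smul_set hy, (2 : ℝ) • (x - y),
    ⟨smul_mem_smul_set (sub_mem_sub hx hy), ?_⟩, ?_⟩
  · rw [mem_closedBall_zero_iff, norm_smul, Real.norm_ofNat]
    linarith
  · rw [midpoint_eq_smul_add, ← smul_add, add_sub_cancel, smul_smul, invOf_mul_self, one_smul]

theorem exists_finite_midpoint_expansion {K : Set X} (hK : IsCompact K) :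
    ∃ F R : ℕ → Set X, R 0 = K ∧ ∀ n, (F n).Finite ∧ F n ⊆ (2 : ℝ) • R n ∧
      R (n + 1) ⊆ Metric.closedBall 0 (1 / (n + 1)) ∧
      ∀ x ∈ R n, ∃ f ∈ F n, ∃ k ∈ R (n + 1), x = midpoint ℝ f k := by
  choose F R' hF hFK hR' hball hmid using
    fun (n : ℕ) (K : {K : Set X // IsCompact K}) =>
      exists_finite_subset_midpoint K.2 (Nat.one_div_pos_of_nat (α := ℝ) (n := n))
  let R : ℕ → {K : Set X // IsCompact K} :=
    fun n => n.rec ⟨K, hK⟩ fun n L => ⟨R' n L, hR' n L⟩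
  exact ⟨fun n => F n (R n), fun n => (R n).1, rfl,
    fun n => ⟨hF n _, hFK n _, hball n (R n), hmid n (R n)⟩⟩

theorem subset_closure_of_midpoint_expansion {F R : ℕ → Set X} {C : Set X} {r : ℝ}
    (hC : Convex ℝ C) (hFC : ∀ n, F n ⊆ C) (hR : ∀ n, R (n + 1) ⊆ Metric.closedBall 0 r)
    (hmid : ∀ n, ∀ x ∈ R n, ∃ f ∈ F n, ∃ k ∈ R (n + 1), x = midpoint ℝ f k) :
    R 0 ⊆ closure C := by
  intro x hx
  have hiterate : ∀ n, ∃ k ∈ R n, Metric.infDist x C ≤ (1 / 2) ^ n * Metric.infDist k C := by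
    intro n
    induction n with
    | zero => exact ⟨x, hx, by simp⟩
    | succ n ih =>
      obtain ⟨y, hy, hxy⟩ := ih
      obtain ⟨f, hf, k, hk, rfl⟩ := hmid n y hy
      refine ⟨k, hk, hxy.trans ?_⟩
      rw [pow_succ, mul_assoc]
      gcongr
      exact infDist_midpoint_le_of_mem hC (hFC n hf) k
  have hbound : ∀ n, Metric.infDist x C ≤ (1 / 2) ^ (n + 1) * (Metric.infDist 0 C + r) := by
    intro n
    obtain ⟨k, hk, hxk⟩ := hiterate (n + 1)
    have hkr : dist k 0 ≤ r := hR n hk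
    refine hxk.trans ?_
    gcongr
    exact Metric.infDist_le_infDist_add_dist.trans (by gcongr)
  have hlim : Tendsto (fun n : ℕ => (1 / 2 : ℝ) ^ (n + 1) * (Metric.infDist 0 C + r)) atTop
      (𝓝 0) := by
    simpa using ((tendsto_pow_atTop_nhds_zero_of_lt_one (by norm_num : (0 : ℝ) ≤ 1 / 2)
      (by norm_num)).comp (tendsto_add_atTop_nat 1)).mul_const (Metric.infDist 0 C + r)
  obtain ⟨f, hf, -⟩ := hmid 0 x hx
  exact (Metric.mem_closure_iff_infDist_zero ⟨f, hFC 0 hf⟩).2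
    (le_antisymm (ge_of_tendsto' hlim hbound) Metric.infDist_nonneg)

theorem exists_tendsto_zero_subset_closure_convexHull {K : Set X} (hK : IsCompact K) :
    ∃ u : ℕ → X, Tendsto u atTop (𝓝 0) ∧ K ⊆ closure (convexHull ℝ (range u)) := by
  obtain ⟨F, R, rfl, hFR⟩ := exists_finite_midpoint_expansion hK
  choose hfinite hFR hR hmid using hFR
  have hsmall : Tendsto F atTop (𝓝 0).smallSets := by
    rw [← tendsto_add_atTop_iff_nat 1, Metric.nhds_basis_closedBall.smallSets.tendsto_right_iff]
    intro ε hε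
    filter_upwards [tendsto_one_div_add_atTop_nhds_zero_nat.eventually (ge_mem_nhds (half_pos hε))]
      with n hn d hd
    obtain ⟨k, hk, rfl⟩ := hFR _ hd
    have hkn := mem_closedBall_zero_iff.1 (hR n hk)
    rw [mem_closedBall_zero_iff, norm_smul, Real.norm_ofNat]
    linarith
  obtain ⟨u, hu, hFu⟩ := exists_tendsto_zero_iUnion_subset_range hfinite hsmall
  refine ⟨u, hu, subset_closure_of_midpoint_expansion (convex_convexHull ℝ _)
    (fun n => ((subset_iUnion F n).trans hFu).trans (subset_convexHull ℝ _)) (r := 1)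
    (fun n => (hR n).trans (Metric.closedBall_subset_closedBall ?_)) hmid⟩
  rw [div_le_one (by positivity)]
  linarith [n.cast_nonneg (α := ℝ)]

theorem exists_ne_zero_tendsto_zero [Nontrivial X] {u : ℕ → X} (hu : Tendsto u atTop (𝓝 0)) :
    ∃ v : ℕ → X, (∀ n, v n ≠ 0) ∧ Tendsto v atTop (𝓝 0) ∧ range u ⊆ insert 0 (range v) := by
  classical
  obtain ⟨e, he⟩ := exists_ne (0 : X)
  have hlim : Tendsto (fun n : ℕ => (1 / ((n : ℝ) + 1)) • e) atTop (𝓝 0) := by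
    simpa using (tendsto_one_div_add_atTop_nhds_zero_nat (𝕜 := ℝ)).smul_const e
  refine ⟨fun n => if u n = 0 then (1 / ((n : ℝ) + 1)) • e else u n, fun n => ?_,
    hlim.if' hu, ?_⟩
  · dsimp only
    split_ifs with h
    · exact smul_ne_zero Nat.one_div_pos_of_nat.ne' he
    · exact h
  · rintro _ ⟨n, rfl⟩
    by_cases h : u n = 0
    · exact Or.inl h
    · exact Or.inr ⟨n, if_neg h⟩

variable {𝕜 : Type*} [RCLike 𝕜] [NormedSpace 𝕜 X] [IsScalarTower ℝ 𝕜 X]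

variable (𝕜) in
theorem exists_subset_smul_closedCircledHull [Nontrivial X] {K : Set X} (hK : IsCompact K) :
    ∃ (x : ℕ → X) (M : ℝ), 0 < M ∧ (∀ n, x n ≠ 0) ∧ (∀ n, ‖x n‖ ≤ 1) ∧
      Tendsto x atTop (𝓝 0) ∧ K ⊆ M • closedCircledHull 𝕜 x := by
  obtain ⟨u, hu, hKu⟩ := exists_tendsto_zero_subset_closure_convexHull hK
  obtain ⟨v, hv0, hv, huv⟩ := exists_ne_zero_tendsto_zero hu
  obtain ⟨M, hM, hvM⟩ := (Metric.isBounded_range_of_tendsto v hv).exists_pos_norm_le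
  let x : ℕ → X := fun n => M⁻¹ • v n
  refine ⟨x, M, hM, fun n => smul_ne_zero (inv_ne_zero hM.ne') (hv0 n), fun n => ?_,
    by simpa [x] using hv.const_smul M⁻¹, hKu.trans (closure_minimal (convexHull_min ?_ ?_) ?_)⟩
  · rw [norm_smul, norm_inv, Real.norm_of_nonneg hM.le, inv_mul_le_one₀ hM]
    exact hvM _ ⟨n, rfl⟩
  · refine huv.trans (insert_subset ?_ ?_)
    · exact zero_mem_smul_set
        ((balanced_closedCircledHull x).zero_mem ⟨_, mem_closedCircledHull (𝕜 := 𝕜) x 0⟩)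
    · rintro _ ⟨n, rfl⟩
      exact ⟨x n, mem_closedCircledHull x n, smul_inv_smul₀ hM.ne' (v n)⟩
  · exact (convex_closedCircledHull x).smul M
  · exact isClosed_closure.smul_of_ne_zero hM.ne'

theorem nonempty_willisSequence (hX : ¬ HasApproximationProperty 𝕜 X) :
    Nonempty (WillisSequence 𝕜 X) := by
  simp only [HasApproximationProperty, not_forall, not_exists, not_and, not_le] at hX
  obtain ⟨K, hK, ε, hε, hfail⟩ := hX
  have : Nontrivial X := by
    obtain ⟨y, -, hy⟩ := hfail 0 (zero_mem _)
    exact nontrivial_of_ne y 0 (by rintro rfl; simp [hε.not_gt] at hy)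
  obtain ⟨x, M, hM, hx0, hx1, hx, hKx⟩ := exists_subset_smul_closedCircledHull 𝕜 hK
  refine ⟨x, fun n => norm_pos_iff.2 (hx0 n), hx1, by simpa using hx.norm, ε / M, by positivity,
    fun V hV => ?_⟩
  obtain ⟨_, hy, hVy⟩ := hfail V hV
  obtain ⟨z, hz, rfl⟩ := hKx hy
  refine ⟨z, hz, (div_le_iff₀' hM).2 ?_⟩
  calc ε ≤ ‖M • z - V (M • z)‖ := hVy.le
    _ = M * ‖z - V z‖ := by
      rw [V.map_smul_of_tower, ← smul_sub, norm_smul, Real.norm_of_nonneg hM.le]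

end NullSequence

section CompactHull

variable {𝕜 X Y : Type*} [RCLike 𝕜]
  [NormedAddCommGroup X] [NormedSpace 𝕜 X] [NormedSpace ℝ X] [IsScalarTower ℝ 𝕜 X]
  [NormedAddCommGroup Y] [NormedSpace 𝕜 Y] [NormedSpace ℝ Y] [CompleteSpace Y]
  {u : ℕ → Y}

theorem isCompact_closedCircledHull (hu : Tendsto u atTop (𝓝 0)) :
    IsCompact (closedCircledHull 𝕜 u) := by
  have hK : IsCompact ((fun p : 𝕜 × Y => p.1 • p.2) '' (Metric.sphere 0 1 ×ˢ insert 0 (range u))) :=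
    ((isCompact_sphere 0 1).prod hu.isCompact_insert_range).image continuous_smul
  refine (hK.totallyBounded.subset ?_).convexHull.closure.isCompact_of_isClosed
    isClosed_closure
  rintro _ ⟨n, c, hc, rfl⟩
  exact ⟨(c, u n), ⟨mem_sphere_zero_iff_norm.2 hc, mem_insert_of_mem _ ⟨n, rfl⟩⟩, rfl⟩

variable [IsScalarTower ℝ 𝕜 Y]

theorem closedCircledHull_comp_subset_image (J : Y →L[𝕜] X)
    (hu : Tendsto u atTop (𝓝 0)) :
    closedCircledHull 𝕜 (J ∘ u) ⊆ J '' closedCircledHull 𝕜 u := by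
  refine closure_minimal (convexHull_min ?_ ?_)
    ((isCompact_closedCircledHull (𝕜 := 𝕜) hu).image J.continuous).isClosed
  · rintro _ ⟨n, c, hc, rfl⟩
    exact ⟨c • u n, (balanced_closedCircledHull u).smul_mem hc.le (mem_closedCircledHull u n),
      map_smul J c (u n)⟩
  · exact (convex_closedCircledHull u).linear_image (J.restrictScalars ℝ).toLinearMap

theorem isCompact_preimage_closedCircledHull_comp {J : Y →L[𝕜] X}
    (hJ : Function.Injective J) (hu : Tendsto u atTop (𝓝 0)) :
    IsCompact (J ⁻¹' closedCircledHull 𝕜 (J ∘ u)) := by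
  refine (isCompact_closedCircledHull (𝕜 := 𝕜) hu).of_isClosed_subset
    (isClosed_closure.preimage J.continuous) fun y hy => ?_
  obtain ⟨z, hz, hzy⟩ := closedCircledHull_comp_subset_image J hu hy
  rwa [← hJ hzy]

end CompactHull

section FiniteRankApproximation

variable {𝕜 X Y : Type*} [RCLike 𝕜]
  [NormedAddCommGroup X] [NormedSpace 𝕜 X] [NormedSpace ℝ X] [IsScalarTower ℝ 𝕜 X]
  [NormedAddCommGroup Y] [NormedSpace 𝕜 Y] [NormedSpace ℝ Y] [IsScalarTower ℝ 𝕜 Y]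

theorem exists_norm_apply_lt_re_of_notMem {A : Set X} (hA : IsClosed A) (hc : Convex ℝ A)
    (hb : Balanced 𝕜 A) {p : X} (hp : p ∉ A) :
    ∃ f : X →L[𝕜] 𝕜, ∀ a ∈ A, ‖f a‖ < RCLike.re (f p) := by
  obtain ⟨f, u, hfA, hfp⟩ := RCLike.geometric_hahn_banach_closed_point (𝕜 := 𝕜) hc hA hp
  refine ⟨f, fun a ha => ?_⟩
  obtain ⟨θ, hθ, hθa⟩ := RCLike.exists_norm_eq_mul_self (f a)
  calc ‖f a‖ = RCLike.re (f (θ • a)) := by rw [map_smul, smul_eq_mul, ← hθa, RCLike.ofReal_re]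
    _ < u := hfA _ (hb.smul_mem hθ.le ha)
    _ < RCLike.re (f p) := hfp

theorem exists_norm_add_mul_le {C : Set Y} (hC : IsCompact C) (hc : Convex ℝ C)
    (hb : Balanced 𝕜 C) (hne : C.Nonempty) (J : Y →L[𝕜] X) (hJ : InjOn J C) (φ : Y →L[𝕜] 𝕜)
    {ε : ℝ} (hε : 0 < ε) :
    ∃ (g : X →L[𝕜] 𝕜) (c : 𝕜), c ≠ 0 ∧ ∀ y ∈ C, ‖g (J y) + c * φ y‖ ≤ ε * ‖c‖ := by
  have h0 : (0 : Y) ∈ C := hb.zero_mem hne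
  let G : Y →L[𝕜] X × 𝕜 := J.prod φ
  have hGc : Convex ℝ (G '' C) := hc.linear_image (G.restrictScalars ℝ).toLinearMap
  have hGb : Balanced 𝕜 (G '' C) := balanced_iff_smul_mem.2 fun a ha _ ⟨y, hy, hGy⟩ =>
    ⟨a • y, hb.smul_mem ha hy, by rw [map_smul, hGy]⟩
  have hp : ((0 : X), (ε : 𝕜)) ∉ G '' C := by
    rintro ⟨y, hy, hGy⟩
    obtain rfl : y = 0 := hJ hy h0 ((Prod.ext_iff.1 hGy).1.trans (map_zero J).symm)
    simpa [hε.ne', G] using (Prod.ext_iff.1 hGy).2.symm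
  obtain ⟨f, hf⟩ := exists_norm_apply_lt_re_of_notMem (hC.image G.continuous).isClosed hGc hGb hp
  have hsplit : ∀ x a, f (x, a) = f (x, 0) + f (0, 1) * a := fun x a => by
    rw [mul_comm, ← smul_eq_mul, ← map_smul, ← map_add]
    simp
  have hbound : ∀ y ∈ C, ‖f (J y, φ y)‖ < ε * ‖f (0, 1)‖ := fun y hy =>
    calc ‖f (J y, φ y)‖ < RCLike.re (f (0, (ε : 𝕜))) := hf _ ⟨y, hy, rfl⟩
      _ = ε * RCLike.re (f (0, 1)) := by
        rw [hsplit, mul_comm, ← Prod.zero_eq_mk, map_zero, zero_add, RCLike.re_ofReal_mul]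
      _ ≤ ε * ‖f (0, 1)‖ := mul_le_mul_of_nonneg_left (RCLike.re_le_norm _) hε.le
  refine ⟨f.comp (ContinuousLinearMap.inl 𝕜 X 𝕜), f (0, 1), fun h => ?_, fun y hy => ?_⟩
  · have := (norm_nonneg _).trans_lt (hbound 0 h0)
    simp [h] at this
  · simpa only [ContinuousLinearMap.comp_apply, ContinuousLinearMap.inl_apply, ← hsplit]
      using (hbound y hy).le

theorem exists_functional_approx {C : Set Y} (hC : IsCompact C) (hc : Convex ℝ C)
    (hb : Balanced 𝕜 C) (J : Y →L[𝕜] X) (hJ : InjOn J C) (φ : Y →L[𝕜] 𝕜) {ε : ℝ} (hε : 0 < ε) :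
    ∃ g : X →L[𝕜] 𝕜, ∀ y ∈ C, ‖g (J y) - φ y‖ ≤ ε := by
  rcases C.eq_empty_or_nonempty with rfl | hne
  · exact ⟨0, by simp⟩
  obtain ⟨g, c, hc0, hg⟩ := exists_norm_add_mul_le hC hc hb hne J hJ φ hε
  refine ⟨-c⁻¹ • g, fun y hy => ?_⟩
  have hdiff : (-c⁻¹ • g) (J y) - φ y = -c⁻¹ * (g (J y) + c * φ y) := by
    rw [smul_apply, smul_eq_mul, mul_add, neg_mul c⁻¹ (c * φ y), inv_mul_cancel_left₀ hc0,
      sub_eq_add_neg]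
  rw [hdiff, norm_mul, norm_neg, norm_inv, inv_mul_le_iff₀ (norm_pos_iff.2 hc0),
    mul_comm ‖c‖]
  exact hg y hy

theorem exists_finiteRank_approx {C : Set Y} (hC : IsCompact C) (hc : Convex ℝ C)
    (hb : Balanced 𝕜 C) (J : Y →L[𝕜] X) (hJ : InjOn J C)
    {E : Type*} [NormedAddCommGroup E] [NormedSpace 𝕜 E] (W : Y →L[𝕜] E)
    [FiniteDimensional 𝕜 (LinearMap.range W.toLinearMap)] {ε : ℝ} (hε : 0 < ε) :
    ∃ V : X →L[𝕜] E, FiniteDimensional 𝕜 (LinearMap.range V.toLinearMap) ∧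
      ∀ y ∈ C, ‖V (J y) - W y‖ ≤ ε := by
  let R := LinearMap.range W.toLinearMap
  let b := Module.finBasis 𝕜 R
  let W' : Y →L[𝕜] R := W.codRestrict R fun y => ⟨y, rfl⟩
  let φ := fun i => (LinearMap.toContinuousLinearMap (b.coord i)).comp W'
  set M : ℝ := ∑ i, ‖b i‖
  have hM : 0 ≤ M := by positivity
  choose g hg using fun i =>
    exists_functional_approx hC hc hb J hJ (φ i) (show 0 < ε / (M + 1) by positivity)
  let V : X →L[𝕜] R := ∑ i, (g i).smulRight (b i)
  refine ⟨R.subtypeL.comp V, Submodule.finiteDimensional_of_le (S₂ := R) ?_, fun y hy => ?_⟩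
  · rintro _ ⟨x, rfl⟩
    exact (V x).2
  · have hW : W' y = ∑ i, φ i y • b i := (b.sum_repr (W' y)).symm
    calc ‖R.subtypeL.comp V (J y) - W y‖ = ‖V (J y) - W' y‖ := rfl
      _ = ‖∑ i, (g i (J y) - φ i y) • b i‖ := by
        simp [V, hW, sub_smul, Finset.sum_sub_distrib]
      _ ≤ ∑ i, ε / (M + 1) * ‖b i‖ := norm_sum_le_of_le _ fun i _ => by
        rw [norm_smul]
        gcongr
        exact hg i y hy
      _ = M / (M + 1) * ε := by rw [← Finset.mul_sum]; ring
      _ ≤ ε := mul_le_of_le_one_left hε.le (div_le_one_of_le₀ (by linarith) (by linarith))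

end FiniteRankApproximation

/-- A nonempty closed bounded absolutely convex subset of `X`. -/
structure ClosedDisc (𝕜 X : Type*) [RCLike 𝕜] [NormedAddCommGroup X] [NormedSpace 𝕜 X]
    [NormedSpace ℝ X] where
  carrier : Set X
  nonempty : carrier.Nonempty
  convex : Convex ℝ carrier
  balanced : Balanced 𝕜 carrier
  isClosed : IsClosed carrier
  isBounded : Bornology.IsBounded carrier

namespace ClosedDisc

variable {𝕜 X : Type*} [RCLike 𝕜] [NormedAddCommGroup X] [NormedSpace 𝕜 X] [NormedSpace ℝ X]
  (B C : ClosedDisc 𝕜 X)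

/-- The linear span of a disc as a type of its own: it is normed by the Minkowski functional of
the disc instead of the norm of `X`. -/
def Space : Type _ := Submodule.span 𝕜 B.carrier

instance : AddCommGroup B.Space := inferInstanceAs (AddCommGroup (Submodule.span 𝕜 B.carrier))

instance : Module 𝕜 B.Space := inferInstanceAs (Module 𝕜 (Submodule.span 𝕜 B.carrier))

/-- The inclusion into `X` as a linear map. -/
def valₗ : B.Space →ₗ[𝕜] X := (Submodule.span 𝕜 B.carrier).subtype

/-- A vector in the span of the disc as an element of the normed space. -/
def ofMem (x : X) (hx : x ∈ Submodule.span 𝕜 B.carrier) : B.Space := ⟨x, hx⟩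

variable {B C}

theorem valₗ_injective : Function.Injective B.valₗ := Subtype.val_injective

theorem valₗ_mem (y : B.Space) : B.valₗ y ∈ Submodule.span 𝕜 B.carrier := y.2

variable [IsScalarTower ℝ 𝕜 X]

theorem mem_smul_of_gauge_lt {y : X} (hy : y ∈ Submodule.span 𝕜 B.carrier) {r : ℝ}
    (hr : gauge B.carrier y < r) : y ∈ r • B.carrier := by
  obtain ⟨q, ⟨hq, z, hz, rfl⟩, hqr⟩ := exists_lt_of_csInf_lt
    (show {q ∈ Ioi (0 : ℝ) | y ∈ q • B.carrier}.Nonempty from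
      exists_mem_smul_of_mem_span B.convex B.balanced B.nonempty hy) hr
  have hr0 : 0 < r := (mem_Ioi.1 hq).trans hqr
  refine ⟨(q / r) • z, B.convex.smul_mem_of_zero_mem (B.balanced.zero_mem B.nonempty) hz
    ⟨div_nonneg (mem_Ioi.1 hq).le hr0.le, (div_le_one hr0).2 hqr.le⟩, ?_⟩
  simp only [smul_smul, mul_div_cancel₀ _ hr0.ne']

theorem norm_le_mul_gauge {R : ℝ} (hR : B.carrier ⊆ Metric.closedBall 0 R) {y : X}
    (hy : y ∈ Submodule.span 𝕜 B.carrier) : ‖y‖ ≤ R * gauge B.carrier y := by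
  have hbound : ∀ r, gauge B.carrier y < r → ‖y‖ ≤ R * r := fun r hr => by
    obtain ⟨z, hz, rfl⟩ := mem_smul_of_gauge_lt hy hr
    simp only [norm_smul, Real.norm_of_nonneg ((gauge_nonneg _).trans_lt hr).le, mul_comm R]
    gcongr
    · exact (gauge_nonneg _).trans hr.le
    · exact mem_closedBall_zero_iff.1 (hR hz)
  exact ge_of_tendsto ((continuous_const_mul R).continuousWithinAt (s := Ioi _))
    (eventually_nhdsWithin_of_forall hbound)

noncomputable instance : NormedAddCommGroup B.Space :=
  AddGroupNorm.toNormedAddCommGroup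
    { toFun := fun y => gauge B.carrier (B.valₗ y)
      map_zero' := by simp
      add_le' := fun y z => by
        rw [map_add]
        exact gauge_add_le_of_mem_span B.convex B.balanced B.nonempty (valₗ_mem y) (valₗ_mem z)
      neg' := fun y => by
        rw [map_neg, ← neg_one_smul 𝕜, gauge_smul B.balanced, norm_neg, norm_one, one_mul]
      eq_zero_of_map_eq_zero' := fun y hy => by
        obtain ⟨R, hR⟩ := B.isBounded.subset_closedBall 0
        refine valₗ_injective (norm_le_zero_iff.1 ?_ |>.trans (map_zero _).symm)
        simpa [hy] using norm_le_mul_gauge hR (valₗ_mem y) }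

noncomputable instance : NormedSpace 𝕜 B.Space where
  norm_smul_le c y := (congrArg _ (map_smul B.valₗ c y)).trans_le (gauge_smul B.balanced c _).le

noncomputable instance : NormedSpace ℝ B.Space := NormedSpace.restrictScalars ℝ 𝕜 B.Space

instance : IsScalarTower ℝ 𝕜 B.Space where
  smul_assoc r c y := by
    change (r • c) • y = algebraMap ℝ 𝕜 r • c • y
    rw [Algebra.smul_def, mul_smul]

variable (B) in
/-- The inclusion into `X`. -/
noncomputable def val : B.Space →L[𝕜] X :=
  B.valₗ.mkContinuousOfExistsBound <|
    let ⟨R, hR⟩ := B.isBounded.subset_closedBall 0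
    ⟨R, fun y => norm_le_mul_gauge hR (valₗ_mem y)⟩

theorem val_injective : Function.Injective B.val := valₗ_injective

theorem val_mem (y : B.Space) : B.val y ∈ Submodule.span 𝕜 B.carrier := valₗ_mem y

theorem norm_eq_gauge (y : B.Space) : ‖y‖ = gauge B.carrier (B.val y) := rfl

theorem val_real_smul (r : ℝ) (y : B.Space) : B.val (r • y) = r • B.val y :=
  B.val.map_smul_of_tower r y

theorem norm_val_le {R : ℝ} (hR : B.carrier ⊆ Metric.closedBall 0 R) (y : B.Space) :
    ‖B.val y‖ ≤ R * ‖y‖ :=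
  norm_le_mul_gauge hR (val_mem y)

theorem norm_le_of_val_mem_smul {r : ℝ} (hr : 0 ≤ r) {y : B.Space}
    (hy : B.val y ∈ r • B.carrier) : ‖y‖ ≤ r :=
  gauge_le_of_mem hr hy

theorem val_mem_smul_of_norm_lt {r : ℝ} {y : B.Space} (hy : ‖y‖ < r) :
    B.val y ∈ r • B.carrier :=
  mem_smul_of_gauge_lt (val_mem y) hy

theorem exists_val_eq_of_mem {x : X} (hx : x ∈ B.carrier) : ∃ y, B.val y = x :=
  ⟨B.ofMem x (Submodule.subset_span hx), rfl⟩

instance [CompleteSpace X] : CompleteSpace B.Space := by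
  refine Metric.complete_of_cauchySeq_tendsto fun u hu => ?_
  obtain ⟨x, hx⟩ := cauchySeq_tendsto_of_complete (B.val.uniformContinuous.comp_cauchySeq hu)
  have hclose : ∀ ε : ℝ, 0 < ε → ∃ N, ∀ n ≥ N, B.val (u n) - x ∈ ε • B.carrier := by
    intro ε hε
    obtain ⟨N, hN⟩ := Metric.cauchySeq_iff.1 hu ε hε
    refine ⟨N, fun n hn => (B.isClosed.smul_of_ne_zero hε.ne').mem_of_tendsto
      (tendsto_const_nhds.sub hx) (eventually_atTop.2 ⟨N, fun m hm => ?_⟩)⟩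
    rw [Function.comp_apply, ← map_sub]
    exact val_mem_smul_of_norm_lt (dist_eq_norm (u n) (u m) ▸ hN n hn m hm)
  obtain ⟨N, hN⟩ := hclose 1 one_pos
  obtain ⟨z, hz⟩ := exists_val_eq_of_mem (one_smul ℝ B.carrier ▸ hN N le_rfl)
  have hlim : B.val (u N - z) = x := by rw [map_sub, hz, sub_sub_cancel]
  refine ⟨u N - z, Metric.tendsto_atTop'.2 fun ε hε => ?_⟩
  obtain ⟨M, hM⟩ := hclose (ε / 2) (half_pos hε)
  refine ⟨M, fun n hn => ?_⟩
  rw [dist_eq_norm]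
  refine (norm_le_of_val_mem_smul (half_pos hε).le ?_).trans_lt (half_lt_self hε)
  rw [map_sub, hlim]
  exact hM n hn.le

/-- The inclusion map of the spaces of two nested discs. -/
noncomputable def incl (h : B.carrier ⊆ C.carrier) : B.Space →L[𝕜] C.Space :=
  LinearMap.mkContinuous
    (show B.Space →ₗ[𝕜] C.Space from Submodule.inclusion (Submodule.span_mono h)) 1 fun y => by
      rw [one_mul]
      refine le_of_forall_gt_imp_ge_of_dense fun r hr => ?_
      exact norm_le_of_val_mem_smul ((norm_nonneg _).trans hr.le)
        (smul_set_mono h (val_mem_smul_of_norm_lt hr))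

@[simp]
theorem val_incl (h : B.carrier ⊆ C.carrier) (y : B.Space) : C.val (incl h y) = B.val y := rfl

theorem norm_incl_le (h : B.carrier ⊆ C.carrier) (y : B.Space) : ‖incl h y‖ ≤ ‖y‖ := by
  simpa only [one_mul] using
    (incl h).le_of_opNorm_le (LinearMap.mkContinuous_norm_le _ zero_le_one _) y

theorem isCompactOperator_incl (h : B.carrier ⊆ C.carrier)
    (hcompact : IsCompact (C.val ⁻¹' B.carrier)) : IsCompactOperator (incl h) := by
  refine ⟨_, hcompact, mem_of_superset (Metric.ball_mem_nhds 0 one_pos) fun y hy => ?_⟩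
  simpa using val_mem_smul_of_norm_lt (mem_ball_zero_iff.1 hy)

end ClosedDisc

namespace WillisSequence

section Disc

variable {𝕜 X : Type*} [RCLike 𝕜] [NormedAddCommGroup X] [NormedSpace 𝕜 X] [NormedSpace ℝ X]
  (w : WillisSequence 𝕜 X)

theorem U_zero : w.U 0 = closedCircledHull 𝕜 w.x := by
  simp only [U, Real.rpow_zero, inv_one, one_smul]

theorem U_subset_closedBall {t : ℝ} (ht : t ≤ 1) : w.U t ⊆ Metric.closedBall 0 1 := by
  refine closure_minimal (convexHull_min ?_ (convex_closedBall _ _)) Metric.isClosed_closedBall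
  rintro _ ⟨n, c, hc, rfl⟩
  have hpos := w.norm_pos n
  rw [mem_closedBall_zero_iff, norm_smul, hc, one_mul, norm_smul, norm_inv, Real.norm_of_nonneg
    (by positivity), inv_mul_le_one₀ (by positivity)]
  simpa only [Real.rpow_one] using Real.rpow_le_rpow_of_exponent_ge hpos (w.norm_le_one n) ht

variable [IsScalarTower ℝ 𝕜 X]

/-- The set `U_t` as a closed disc, so that `(w.disc t ht).Space` is the normed space
`(Y_t, |·|_t)`. For `t ≤ 1` the set `U_t` is bounded. -/
def disc (t : ℝ) (ht : t ≤ 1) : ClosedDisc 𝕜 X where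
  carrier := w.U t
  nonempty := w.nonempty_U t
  convex := w.convex_U t
  balanced := w.balanced_U t
  isClosed := isClosed_closure
  isBounded := Metric.isBounded_closedBall.subset (w.U_subset_closedBall ht)

variable {s t : ℝ} {hs : s ≤ 1} {ht : t ≤ 1}

theorem disc_subset (hst : s ≤ t) : (w.disc s hs).carrier ⊆ (w.disc t ht).carrier :=
  w.U_mono hst

theorem norm_val_disc_le (y : (w.disc t ht).Space) : ‖(w.disc t ht).val y‖ ≤ ‖y‖ := by
  simpa only [one_mul] using ClosedDisc.norm_val_le (w.U_subset_closedBall ht) y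

theorem isCompact_preimage_U [CompleteSpace X] (hst : s < t) :
    IsCompact ((w.disc t ht).val ⁻¹' w.U s) := by
  choose v hv using fun n => ClosedDisc.exists_val_eq_of_mem (B := w.disc t ht)
    (mem_closedCircledHull (𝕜 := 𝕜) (fun n => (‖w.x n‖ ^ t)⁻¹ • w.x n) n)
  have hv_norm : ∀ n, ‖v n‖ ≤ 1 := fun n => ClosedDisc.norm_le_of_val_mem_smul zero_le_one <| by
    rw [one_smul, hv]
    exact mem_closedCircledHull _ n
  let u : ℕ → (w.disc t ht).Space := fun n => ‖w.x n‖ ^ (t - s) • v n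
  have hu : Tendsto u atTop (𝓝 0) := by
    have hpow : Tendsto (fun n => ‖w.x n‖ ^ (t - s)) atTop (𝓝 0) := by
      simpa only [Real.zero_rpow (sub_pos.2 hst).ne'] using
        w.tendsto_norm.rpow_const (Or.inr (sub_pos.2 hst).le)
    refine squeeze_zero_norm (fun n => ?_) hpow
    rw [norm_smul, Real.norm_of_nonneg (by positivity)]
    exact mul_le_of_le_one_right (by positivity) (hv_norm n)
  have hU : w.U s = closedCircledHull 𝕜 ((w.disc t ht).val ∘ u) := by
    rw [U]
    congr 1
    ext n
    have hpos := w.norm_pos n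
    rw [Function.comp_apply, ClosedDisc.val_real_smul, hv, smul_smul, Real.rpow_sub hpos]
    congr 1
    field_simp
  rw [hU]
  exact isCompact_preimage_closedCircledHull_comp ClosedDisc.val_injective hu

theorem isCompactOperator_incl_disc [CompleteSpace X] (hst : s < t) :
    IsCompactOperator (ClosedDisc.incl (w.disc_subset (hs := hs) (ht := ht) hst.le)) :=
  ClosedDisc.isCompactOperator_incl _ (w.isCompact_preimage_U hst)

theorem le_norm_val_sub [CompleteSpace X] (hs0 : 0 < s) {c : ℝ}
    (hc : ∀ V ∈ finiteRankOperators 𝕜 X, ∃ y ∈ closedCircledHull 𝕜 w.x, c ≤ ‖y - V y‖)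
    (W : (w.disc s hs).Space →L[𝕜] X) [FiniteDimensional 𝕜 (LinearMap.range W.toLinearMap)] :
    c ≤ ‖(w.disc s hs).val - W‖ := by
  refine le_of_forall_pos_le_add fun ε hε => ?_
  obtain ⟨V, hV, hVW⟩ := exists_finiteRank_approx (w.isCompact_preimage_U (ht := hs) hs0)
    ((w.convex_U 0).linear_preimage ((w.disc s hs).val.toLinearMap.restrictScalars ℝ))
    ((w.balanced_U 0).mulActionHom_preimage (w.disc s hs).val.toLinearMap.toMulActionHom)
    (w.disc s hs).val ClosedDisc.val_injective.injOn W hε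
  obtain ⟨x, hx, hcx⟩ := hc V hV
  rw [← U_zero] at hx
  obtain ⟨y, rfl⟩ := ClosedDisc.exists_val_eq_of_mem (B := w.disc s hs) (w.U_mono hs0.le hx)
  have hy : ‖y‖ ≤ 1 := ClosedDisc.norm_le_of_val_mem_smul zero_le_one <|
    (one_smul ℝ (w.U s)).symm ▸ w.U_mono hs0.le hx
  have hW : ‖(w.disc s hs).val y - W y‖ ≤ ‖(w.disc s hs).val - W‖ :=
    ((w.disc s hs).val - W).unit_le_opNorm y hy
  calc c ≤ ‖(w.disc s hs).val y - V ((w.disc s hs).val y)‖ := hcx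
    _ ≤ ‖(w.disc s hs).val y - W y‖ + ‖W y - V ((w.disc s hs).val y)‖ :=
      norm_sub_le_norm_sub_add_norm_sub (_ : X) _ _
    _ ≤ ‖(w.disc s hs).val - W‖ + ε := add_le_add hW ((norm_sub_rev (W y) _).trans_le (hVW y hx))

end Disc

end WillisSequence

/-- An open interval whose closure lies in `(0, 1)`. -/
structure UnitSubinterval where
  left : ℝ
  right : ℝ
  left_pos : 0 < left
  left_lt_right : left < right
  right_lt_one : right < 1

namespace UnitSubinterval

variable (I : UnitSubinterval)

/-- The points of the interval. -/
def toSet : Set ℝ := Ioo I.left I.right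

theorem left_lt_one : I.left < 1 := I.left_lt_right.trans I.right_lt_one

theorem length_pos : 0 < I.right - I.left := sub_pos.2 I.left_lt_right

theorem toSet_subset : I.toSet ⊆ Ioo 0 1 := Ioo_subset_Ioo I.left_pos.le I.right_lt_one.le

theorem measurableSet_toSet : MeasurableSet I.toSet := measurableSet_Ioo

theorem volume_real_toSet : volume.real I.toSet = I.right - I.left :=
  Real.volume_real_Ioo_of_le I.left_lt_right.le

end UnitSubinterval

namespace WillisSequence

section Integration

variable {𝕜 X : Type*} [RCLike 𝕜] [NormedAddCommGroup X] [NormedSpace 𝕜 X] [NormedSpace ℝ X]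
  (w : WillisSequence 𝕜 X)

theorem eval_injective : Function.Injective w.eval := Subtype.val_injective

variable [IsScalarTower ℝ 𝕜 X]

theorem eval_mem_Y (f : w.Simple) (r : ℝ) : w.eval f r ∈ w.Y r :=
  let ⟨_, hC⟩ := w.simple_bounded f
  (hC r).1

variable (I J : UnitSubinterval)

/-- The disc `U_s` at the left endpoint `s` of an interval. -/
abbrev leftDisc : ClosedDisc 𝕜 X := w.disc I.left I.left_lt_one.le

/-- The disc `U_t` at the right endpoint `t` of an interval. -/
abbrev rightDisc : ClosedDisc 𝕜 X := w.disc I.right I.right_lt_one.le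

/-- The map `y ↦ y χ_(s,t)` from `Y_s` to the simple functions. -/
noncomputable def simpleIndicator : (w.leftDisc I).Space →ₗ[𝕜] w.Simple where
  toFun y := (⟨I.toSet.indicator fun _ => (w.leftDisc I).val y,
    Submodule.subset_span ⟨_, _, I.left_pos, I.left_lt_right, I.right_lt_one, _,
      ClosedDisc.val_mem y, rfl⟩⟩ : w.simpleFunctions)
  map_add' y z := w.eval_injective <|
    (congrArg _ (funext fun _ => map_add _ y z)).trans (indicator_add I.toSet _ _)
  map_smul' c y := w.eval_injective <|
    (congrArg _ (funext fun _ => map_smul _ c y)).trans (indicator_const_smul I.toSet c _)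

variable {I} in
theorem eval_simpleIndicator (y : (w.leftDisc I).Space) :
    w.eval (w.simpleIndicator I y) = I.toSet.indicator fun _ => (w.leftDisc I).val y := rfl

theorem simple_induction {p : w.Simple → Prop} (f : w.Simple)
    (indicator : ∀ (I : UnitSubinterval) (y : (w.leftDisc I).Space), p (w.simpleIndicator I y))
    (zero : p 0) (add : ∀ f g, p f → p g → p (f + g)) (smul : ∀ (c : 𝕜) f, p f → p (c • f)) :
    p f := by
  obtain ⟨f, hf⟩ := f
  induction hf using Submodule.span_induction with
  | mem f hf =>
    obtain ⟨s, t, hs, hst, ht, y, hy, rfl⟩ := hf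
    exact indicator ⟨s, t, hs, hst, ht⟩ (ClosedDisc.ofMem _ y hy)
  | zero => exact zero
  | add f g hf hg ihf ihg => exact add ⟨f, hf⟩ ⟨g, hg⟩ ihf ihg
  | smul c f hf ih => exact smul c ⟨f, hf⟩ ih

theorem indicator_eval_mem_Y (f : w.Simple) (r : ℝ) :
    I.toSet.indicator (w.eval f) r ∈ w.Y I.right := by
  by_cases hr : r ∈ I.toSet
  · rw [indicator_of_mem hr]
    exact w.Y_mono hr.2.le (w.eval_mem_Y f r)
  · rw [indicator_of_notMem hr]
    exact zero_mem _

/-- The function `f χ_(s,t)` for a simple function `f`, as a function with values in `Y_t`. -/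
noncomputable def restrict : w.Simple →ₗ[𝕜] ℝ → (w.rightDisc I).Space where
  toFun f r := ClosedDisc.ofMem _ (I.toSet.indicator (w.eval f) r) (w.indicator_eval_mem_Y I f r)
  map_add' f g := funext fun r => ClosedDisc.val_injective <|
    congrFun (indicator_add' I.toSet (w.eval f) (w.eval g)) r
  map_smul' c f := funext fun r => ClosedDisc.val_injective <|
    congrFun (indicator_const_smul I.toSet c (w.eval f)) r

variable {I J}

theorem val_restrict (f : w.Simple) (r : ℝ) :
    (w.rightDisc I).val (w.restrict I f r) = I.toSet.indicator (w.eval f) r := rfl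

theorem restrict_simpleIndicator (h : J.left ≤ I.right) (y : (w.leftDisc J).Space) :
    w.restrict I (w.simpleIndicator J y) = (I.toSet ∩ J.toSet).indicator fun _ =>
      ClosedDisc.incl (C := w.rightDisc I) (w.disc_subset h) y := by
  ext r
  apply ClosedDisc.val_injective
  rw [val_restrict, eval_simpleIndicator, indicator_indicator]
  by_cases hr : r ∈ I.toSet ∩ J.toSet
  · rw [indicator_of_mem hr, indicator_of_mem hr, ClosedDisc.val_incl]
  · rw [indicator_of_notMem hr, indicator_of_notMem hr, map_zero]

theorem restrict_simpleIndicator_of_disjoint (h : Disjoint I.toSet J.toSet)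
    (y : (w.leftDisc J).Space) : w.restrict I (w.simpleIndicator J y) = 0 := by
  ext r
  apply ClosedDisc.val_injective
  rw [val_restrict, eval_simpleIndicator, indicator_indicator, h.inter_eq, indicator_empty]
  exact (map_zero _).symm

theorem restrict_simpleIndicator_self (y : (w.leftDisc I).Space) :
    w.restrict I (w.simpleIndicator I y) = I.toSet.indicator fun _ =>
      ClosedDisc.incl (w.disc_subset I.left_lt_right.le) y := by
  rw [w.restrict_simpleIndicator I.left_lt_right.le, inter_self]

theorem integrable_restrict (f : w.Simple) : Integrable (w.restrict I f) := by
  induction f using w.simple_induction with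
  | indicator J y =>
    by_cases hIJ : Disjoint I.toSet J.toSet
    · rw [w.restrict_simpleIndicator_of_disjoint hIJ]
      exact integrable_zero _ _ _
    · obtain ⟨r, hrI, hrJ⟩ := not_disjoint_iff.1 hIJ
      rw [w.restrict_simpleIndicator (hrJ.1.trans hrI.2).le,
        integrable_indicator_iff (I.measurableSet_toSet.inter J.measurableSet_toSet)]
      exact integrableOn_const
        ((measure_mono inter_subset_left).trans_lt measure_Ioo_lt_top).ne
  | zero =>
    rw [map_zero]
    exact integrable_zero _ _ _
  | add f g hf hg =>
    rw [map_add]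
    exact hf.add hg
  | smul c f hf =>
    rw [map_smul]
    exact hf.smul c

theorem norm_integral_restrict_le (f : w.Simple) :
    ‖∫ r, w.restrict I f r‖ ≤ ∫ r in I.toSet, w.normY r (w.eval f r) := by
  rw [← integral_indicator I.measurableSet_toSet]
  refine norm_integral_le_of_norm_le ((integrable_indicator_iff I.measurableSet_toSet).2
    ((w.simple_integrable f).mono_set I.toSet_subset)) (Eventually.of_forall fun r => ?_)
  rw [ClosedDisc.norm_eq_gauge, val_restrict]
  by_cases hr : r ∈ I.toSet
  · rw [indicator_of_mem hr, indicator_of_mem hr]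
    exact w.normY_anti hr.2.le (w.eval_mem_Y f r)
  · rw [indicator_of_notMem hr, indicator_of_notMem hr, gauge_zero]

theorem sum_norm_integral_restrict_le {ι : Type*} (S : Finset ι) {I : ι → UnitSubinterval}
    (hI : Pairwise fun i j => Disjoint (I i).toSet (I j).toSet) (f : w.Simple) :
    ∑ i ∈ S, ‖∫ r, w.restrict (I i) f r‖ ≤ ‖f‖ :=
  calc ∑ i ∈ S, ‖∫ r, w.restrict (I i) f r‖
      ≤ ∑ i ∈ S, ∫ r in (I i).toSet, w.normY r (w.eval f r) :=
        Finset.sum_le_sum fun _ _ => w.norm_integral_restrict_le f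
    _ = ∫ r in ⋃ i ∈ S, (I i).toSet, w.normY r (w.eval f r) :=
        (integral_biUnion_finset S (fun i _ => (I i).measurableSet_toSet)
          (fun _ _ _ _ hij => hI hij)
          fun i _ => (w.simple_integrable f).mono_set (I i).toSet_subset).symm
    _ ≤ ‖f‖ :=
        setIntegral_mono_set (w.simple_integrable f) (Eventually.of_forall fun _ => gauge_nonneg _)
          (iUnion₂_subset fun i _ => (I i).toSet_subset).eventuallyLE

theorem norm_simpleIndicator_le (y : (w.leftDisc I).Space) :
    ‖w.simpleIndicator I y‖ ≤ (I.right - I.left) * ‖y‖ := by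
  have hpointwise : ∀ r, w.normY r (w.eval (w.simpleIndicator I y) r) ≤
      I.toSet.indicator (fun _ => ‖y‖) r := fun r => by
    rw [eval_simpleIndicator]
    by_cases hr : r ∈ I.toSet
    · rw [indicator_of_mem hr, indicator_of_mem hr]
      exact w.normY_anti hr.1.le (ClosedDisc.val_mem y)
    · rw [indicator_of_notMem hr, indicator_of_notMem hr]
      exact gauge_zero.le
  calc ‖w.simpleIndicator I y‖ ≤ ∫ r in Ioo 0 1, I.toSet.indicator (fun _ => ‖y‖) r :=
        integral_mono (w.simple_integrable _) ((integrable_indicator_iff I.measurableSet_toSet).2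
          (integrable_const _).integrableOn) hpointwise
    _ = (I.right - I.left) * ‖y‖ := by
        rw [setIntegral_indicator I.measurableSet_toSet,
          inter_eq_self_of_subset_right I.toSet_subset, setIntegral_const, I.volume_real_toSet,
          smul_eq_mul]

/-- The canonical map from the simple functions to the Willis space. -/
noncomputable def toSpace : w.Simple →L[𝕜] w.Space :=
  UniformSpace.Completion.toComplL (𝕜 := 𝕜) (E := w.Simple)

theorem denseRange_toSpace : DenseRange w.toSpace :=
  UniformSpace.Completion.denseRange_coe (α := w.Simple)

theorem isUniformInducing_toSpace : IsUniformInducing w.toSpace :=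
  UniformSpace.Completion.isUniformInducing_coe w.Simple

theorem norm_toSpace (f : w.Simple) : ‖w.toSpace f‖ = ‖f‖ :=
  UniformSpace.Completion.norm_coe (E := w.Simple) f

variable (I) in
/-- The map `y ↦ (t - s)⁻¹ y χ_(s,t)` from `Y_s` to the Willis space. -/
noncomputable def spread : (w.leftDisc I).Space →L[𝕜] w.Space :=
  LinearMap.mkContinuous
    (w.toSpace.toLinearMap ∘ₗ (algebraMap ℝ 𝕜 (I.right - I.left)⁻¹ • w.simpleIndicator I)) 1
    fun y => by
      change ‖w.toSpace (algebraMap ℝ 𝕜 (I.right - I.left)⁻¹ • w.simpleIndicator I y)‖ ≤ 1 * ‖y‖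
      rw [norm_toSpace, norm_smul, norm_algebraMap', norm_inv, Real.norm_of_nonneg I.length_pos.le,
        inv_mul_le_iff₀ I.length_pos, one_mul]
      exact w.norm_simpleIndicator_le y

theorem spread_apply (y : (w.leftDisc I).Space) : w.spread I y =
    w.toSpace (algebraMap ℝ 𝕜 (I.right - I.left)⁻¹ • w.simpleIndicator I y) := rfl

theorem norm_spread_le : ‖w.spread I‖ ≤ 1 := LinearMap.mkContinuous_norm_le _ zero_le_one _

variable [CompleteSpace X]

variable (I) in
/-- The map `f ↦ ∫_s^t f` from the Willis space to `Y_t`. -/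
noncomputable def integral : w.Space →L[𝕜] (w.rightDisc I).Space :=
  (LinearMap.mkContinuous
    { toFun := fun f => ∫ r, w.restrict I f r
      map_add' := fun f g => by
        rw [map_add]
        exact integral_add (w.integrable_restrict f) (w.integrable_restrict g)
      map_smul' := fun c f => by
        rw [map_smul]
        exact integral_smul c _ } 1 fun f => by
    simpa using w.sum_norm_integral_restrict_le (Finset.univ : Finset Unit) (I := fun _ => I)
      Subsingleton.pairwise f).extend w.toSpace

theorem integral_toSpace (f : w.Simple) :
    w.integral I (w.toSpace f) = ∫ r, w.restrict I f r :=
  ContinuousLinearMap.extend_eq _ w.denseRange_toSpace w.isUniformInducing_toSpace f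

theorem sum_norm_integral_le {ι : Type*} (S : Finset ι) {I : ι → UnitSubinterval}
    (hI : Pairwise fun i j => Disjoint (I i).toSet (I j).toSet) (z : w.Space) :
    ∑ i ∈ S, ‖w.integral (I i) z‖ ≤ ‖z‖ := by
  refine w.denseRange_toSpace.induction_on (p := fun z => ∑ i ∈ S, ‖w.integral (I i) z‖ ≤ ‖z‖) z
    (isClosed_le (by fun_prop) continuous_norm) fun f => ?_
  simp only [integral_toSpace, norm_toSpace]
  exact w.sum_norm_integral_restrict_le S hI f

theorem norm_integral_le (z : w.Space) : ‖w.integral I z‖ ≤ ‖z‖ := by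
  simpa using w.sum_norm_integral_le (Finset.univ : Finset Unit) (I := fun _ => I)
    Subsingleton.pairwise z

theorem val_integral_spread (y : (w.leftDisc I).Space) :
    (w.rightDisc I).val (w.integral I (w.spread I y)) = (w.leftDisc I).val y := by
  rw [spread_apply, map_smul, map_smul, integral_toSpace, restrict_simpleIndicator_self,
    integral_indicator I.measurableSet_toSet, setIntegral_const, I.volume_real_toSet, map_smul,
    algebraMap_smul, ClosedDisc.val_real_smul, inv_smul_smul₀ I.length_pos.ne',
    ClosedDisc.val_incl]

theorem integral_spread_of_disjoint (h : Disjoint I.toSet J.toSet) (y : (w.leftDisc J).Space) :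
    w.integral I (w.spread J y) = 0 := by
  rw [spread_apply, map_smul, map_smul, integral_toSpace,
    w.restrict_simpleIndicator_of_disjoint h]
  simp only [Pi.zero_apply, integral_zero, smul_zero]

end Integration

end WillisSequence

section Quotient

variable {𝕜 X Y Z : Type*} [RCLike 𝕜] [NormedAddCommGroup X] [NormedSpace 𝕜 X]
  [NormedAddCommGroup Y] [NormedSpace 𝕜 Y] [NormedAddCommGroup Z] [NormedSpace 𝕜 Z]

theorem mul_norm_le_norm_sub_of_comp_eq_smul {c : ℝ} {D V : Z →L[𝕜] Z} {Q : Z →L[𝕜] X}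
    {J : Y →L[𝕜] Z} {i : Y →L[𝕜] X} {k : 𝕜} (hQ : ‖Q‖ ≤ 1) (hJ : ‖J‖ ≤ 1)
    (hi : ∀ W : Y →L[𝕜] X, FiniteDimensional 𝕜 (LinearMap.range W.toLinearMap) → c ≤ ‖i - W‖)
    (hD : Q ∘L D ∘L J = k • i) (hV : V ∈ finiteRankOperators 𝕜 Z) : c * ‖k‖ ≤ ‖D - V‖ := by
  rcases eq_or_ne k 0 with rfl | hk
  · simp only [norm_zero, mul_zero, norm_nonneg]
  have hfin : FiniteDimensional 𝕜 (LinearMap.range (k⁻¹ • Q ∘L V ∘L J).toLinearMap) := by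
    have : FiniteDimensional 𝕜 (LinearMap.range V.toLinearMap) := hV
    refine Submodule.finiteDimensional_of_le
      (S₂ := (LinearMap.range V.toLinearMap).map Q.toLinearMap) ?_
    rintro _ ⟨y, rfl⟩
    exact Submodule.smul_mem _ _ ⟨_, ⟨J y, rfl⟩, rfl⟩
  calc c * ‖k‖ ≤ ‖i - k⁻¹ • Q ∘L V ∘L J‖ * ‖k‖ := by gcongr; exact hi _ hfin
    _ = ‖Q ∘L (D - V) ∘L J‖ := by
        rw [mul_comm, ← norm_smul, smul_sub, smul_inv_smul₀ hk, ← hD,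
          ContinuousLinearMap.sub_comp, ContinuousLinearMap.comp_sub]
    _ ≤ ‖Q‖ * (‖D - V‖ * ‖J‖) := (Q.opNorm_comp_le _).trans
        (mul_le_mul_of_nonneg_left ((D - V).opNorm_comp_le J) (norm_nonneg Q))
    _ ≤ 1 * (‖D - V‖ * 1) := by gcongr
    _ = ‖D - V‖ := by rw [one_mul, mul_one]

theorem le_norm_mk_approximableInCompact {T : CompactOperators 𝕜 Z} {δ : ℝ}
    (hT : ∀ V ∈ finiteRankOperators 𝕜 Z, δ ≤ ‖(T : Z →L[𝕜] Z) - V‖) :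
    δ ≤ ‖(Submodule.Quotient.mk T : CompactOperators 𝕜 Z ⧸ approximableInCompact 𝕜 Z)‖ := by
  refine le_of_forall_pos_lt_add fun ε hε => ?_
  obtain ⟨S, hS, hlt⟩ := Submodule.Quotient.norm_mk_lt
    (Submodule.Quotient.mk T : CompactOperators 𝕜 Z ⧸ approximableInCompact 𝕜 Z) hε
  have hmem : ((T - S : CompactOperators 𝕜 Z) : Z →L[𝕜] Z) ∈
      closure (finiteRankOperators 𝕜 Z : Set (Z →L[𝕜] Z)) :=
    (Submodule.Quotient.eq _).1 hS.symm
  have hclosed : IsClosed {V : Z →L[𝕜] Z | δ ≤ ‖(T : Z →L[𝕜] Z) - V‖} :=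
    isClosed_le continuous_const (by fun_prop)
  have hle : δ ≤ ‖(T : Z →L[𝕜] Z) - ((T - S : CompactOperators 𝕜 Z) : Z →L[𝕜] Z)‖ :=
    closure_minimal hT hclosed hmem
  rw [Submodule.coe_sub, sub_sub_cancel] at hle
  exact hle.trans_lt hlt

end Quotient

section Diagonal

variable {ι 𝕜 E : Type*} [TopologicalSpace ι] [DiscreteTopology ι] [RCLike 𝕜]
  [NormedAddCommGroup E] [NormedSpace 𝕜 E] [CompleteSpace E] {T : ι → E} {M : ℝ}

theorem summable_smul_of_norm_sum_smul_le (hM : 0 < M)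
    (hT : ∀ (S : Finset ι) (a : ι → 𝕜) (C : ℝ), 0 ≤ C → (∀ n ∈ S, ‖a n‖ ≤ C) →
      ‖∑ n ∈ S, a n • T n‖ ≤ M * C) (a : C₀(ι, 𝕜)) : Summable fun n => a n • T n := by
  refine summable_iff_vanishing_norm.2 fun ε hε => ?_
  have hδ : 0 < ε / (2 * M) := by positivity
  have hfinite : {n | ¬ dist (a n) 0 < ε / (2 * M)}.Finite := by
    have ha := a.zero_at_infty'
    rw [cocompact_eq_cofinite] at ha
    exact eventually_cofinite.1 (Metric.tendsto_nhds.1 ha _ hδ)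
  refine ⟨hfinite.toFinset, fun S hS => ?_⟩
  calc ‖∑ n ∈ S, a n • T n‖ ≤ M * (ε / (2 * M)) := hT S a _ hδ.le fun n hn => by
        by_contra hlarge
        refine Finset.disjoint_left.1 hS hn (hfinite.mem_toFinset.2 ?_)
        rw [mem_ofPred_eq, dist_zero_right]
        exact fun hsmall => hlarge hsmall.le
    _ < ε := by field_simp; norm_num

theorem exists_hasSum_smul_of_norm_sum_smul_le (hM : 0 < M)
    (hT : ∀ (S : Finset ι) (a : ι → 𝕜) (C : ℝ), 0 ≤ C → (∀ n ∈ S, ‖a n‖ ≤ C) →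
      ‖∑ n ∈ S, a n • T n‖ ≤ M * C) :
    ∃ Φ : C₀(ι, 𝕜) →L[𝕜] E, ∀ a, HasSum (fun n => a n • T n) (Φ a) := by
  have hsum := summable_smul_of_norm_sum_smul_le hM hT
  let Φ : C₀(ι, 𝕜) →ₗ[𝕜] E :=
    { toFun := fun a => ∑' n, a n • T n
      map_add' := fun a b => by
        rw [← (hsum a).tsum_add (hsum b)]
        simp only [ZeroAtInftyContinuousMap.add_apply, add_smul]
      map_smul' := fun c a => by
        rw [RingHom.id_apply, ← (hsum a).tsum_const_smul c]
        simp only [ZeroAtInftyContinuousMap.smul_apply, smul_assoc] }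
  refine ⟨Φ.mkContinuous M fun a => ?_, fun a => (hsum a).hasSum⟩
  exact le_of_tendsto (hsum a).hasSum.norm <| Eventually.of_forall fun S =>
    hT S a _ (norm_nonneg a) fun n _ => a.toBCF.norm_coe_le_norm n

theorem exists_embedding_of_le_norm_sub {Z : Type*} [NormedAddCommGroup Z] [NormedSpace 𝕜 Z]
    [CompleteSpace Z] {T : ι → Z →L[𝕜] Z} (hT : ∀ n, IsCompactOperator (T n)) (hM : 0 < M)
    (hsum : ∀ (S : Finset ι) (a : ι → 𝕜) (C : ℝ), 0 ≤ C → (∀ n ∈ S, ‖a n‖ ≤ C) →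
      ‖∑ n ∈ S, a n • T n‖ ≤ M * C) {δ : ℝ} (hδ : 0 < δ)
    (hlower : ∀ (a : ι → 𝕜) (D : Z →L[𝕜] Z), HasSum (fun n => a n • T n) D →
      ∀ n, ∀ V ∈ finiteRankOperators 𝕜 Z, δ * ‖a n‖ ≤ ‖D - V‖) :
    ∃ ψ : C₀(ι, 𝕜) →L[𝕜] CompactByApproximable 𝕜 Z,
      ∃ δ : ℝ, 0 < δ ∧ ∀ a : C₀(ι, 𝕜), δ * ‖a‖ ≤ ‖ψ a‖ := by
  obtain ⟨Φ, hΦ⟩ := exists_hasSum_smul_of_norm_sum_smul_le hM hsum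
  have hcompact : ∀ a, Φ a ∈ CompactOperators 𝕜 Z := fun a =>
    isClosed_setOfPred_isCompactOperator.mem_of_tendsto (hΦ a) <| Eventually.of_forall fun S =>
      (CompactOperators 𝕜 Z).sum_mem fun n _ => (CompactOperators 𝕜 Z).smul_mem _ (hT n)
  refine ⟨(approximableInCompact 𝕜 Z).mkQL ∘L Φ.codRestrict _ hcompact, δ, hδ, fun a => ?_⟩
  refine le_norm_mk_approximableInCompact (T := ⟨Φ a, hcompact a⟩) fun V hV => ?_
  rw [mul_comm, ← le_div_iff₀ hδ]
  refine (BoundedContinuousFunction.norm_le (f := a.toBCF) (by positivity)).2 fun n => ?_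
  rw [le_div_iff₀' hδ]
  exact hlower a (Φ a) (hΦ a) n V hV

end Diagonal

namespace WillisSequence

section Transfer

variable {𝕜 X : Type*} [RCLike 𝕜] [NormedAddCommGroup X] [NormedSpace 𝕜 X] [NormedSpace ℝ X]
  [IsScalarTower ℝ 𝕜 X] [CompleteSpace X] (w : WillisSequence 𝕜 X)

section

variable {I J : UnitSubinterval} (h : I.right < J.left)

/-- The operator that integrates over the interval `I` and spreads the result evenly over an
interval `J` further to the right. -/
noncomputable def transfer : w.Space →L[𝕜] w.Space :=
  w.spread J ∘L ClosedDisc.incl (w.disc_subset h.le) ∘L w.integral I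

theorem transfer_apply (z : w.Space) : w.transfer h z =
    w.spread J (ClosedDisc.incl (w.disc_subset h.le) (w.integral I z)) := rfl

theorem isCompactOperator_transfer : IsCompactOperator (w.transfer h) :=
  ((w.isCompactOperator_incl_disc h).comp_clm (w.integral I)).clm_comp (w.spread J)

theorem norm_transfer_apply_le (z : w.Space) : ‖w.transfer h z‖ ≤ ‖w.integral I z‖ :=
  ((w.spread J).le_of_opNorm_le w.norm_spread_le _).trans <|
    (one_mul _).trans_le (ClosedDisc.norm_incl_le (w.disc_subset h.le) _)

theorem val_integral_transfer (z : w.Space) :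
    (w.rightDisc J).val (w.integral J (w.transfer h z)) = (w.rightDisc I).val (w.integral I z) := by
  rw [transfer_apply, val_integral_spread, ClosedDisc.val_incl]

end

variable {ι : Type*} {I : ι → UnitSubinterval} {J : UnitSubinterval}
  (hI : Pairwise fun i j => Disjoint (I i).toSet (I j).toSet) (hJ : ∀ i, (I i).right < J.left)

include hI

theorem norm_sum_smul_transfer_le (S : Finset ι) (a : ι → 𝕜) {C : ℝ} (hC : 0 ≤ C)
    (ha : ∀ i ∈ S, ‖a i‖ ≤ C) : ‖∑ i ∈ S, a i • w.transfer (hJ i)‖ ≤ C := by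
  refine ContinuousLinearMap.opNorm_le_bound _ hC fun z => ?_
  calc ‖(∑ i ∈ S, a i • w.transfer (hJ i)) z‖ = ‖∑ i ∈ S, a i • w.transfer (hJ i) z‖ := by
        simp only [sum_apply, smul_apply]
    _ ≤ ∑ i ∈ S, C * ‖w.integral (I i) z‖ := norm_sum_le_of_le _ fun i hi => by
        rw [norm_smul]
        exact mul_le_mul (ha i hi) (w.norm_transfer_apply_le (hJ i) z) (norm_nonneg _) hC
    _ = C * ∑ i ∈ S, ‖w.integral (I i) z‖ := (Finset.mul_sum _ _ _).symm
    _ ≤ C * ‖z‖ := mul_le_mul_of_nonneg_left (w.sum_norm_integral_le S hI z) hC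

theorem val_integral_comp_spread_of_hasSum {a : ι → 𝕜} {D : w.Space →L[𝕜] w.Space}
    (hD : HasSum (fun i => a i • w.transfer (hJ i)) D) (i : ι) :
    ((w.rightDisc J).val ∘L w.integral J) ∘L D ∘L w.spread (I i) =
      a i • (w.leftDisc (I i)).val := by
  ext y
  let evalAt : (w.Space →L[𝕜] w.Space) →L[𝕜] X :=
    ((w.rightDisc J).val ∘L w.integral J) ∘L ContinuousLinearMap.apply 𝕜 w.Space (w.spread (I i) y)
  have hterm : ∀ j, evalAt (a j • w.transfer (hJ j)) =
      a j • (w.rightDisc (I j)).val (w.integral (I j) (w.spread (I i) y)) := fun j => by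
    rw [map_smul, ← w.val_integral_transfer (hJ j)]
    rfl
  have hoff : ∀ j, j ≠ i → evalAt (a j • w.transfer (hJ j)) = 0 := fun j hj => by
    rw [hterm, w.integral_spread_of_disjoint (hI hj), map_zero, smul_zero]
  have hdiag : evalAt (a i • w.transfer (hJ i)) = a i • (w.leftDisc (I i)).val y := by
    rw [hterm, w.val_integral_spread]
  exact ((hD.mapL evalAt).unique (hasSum_single i hoff)).trans hdiag

theorem mul_norm_le_norm_sub_of_hasSum {c : ℝ}
    (hc : ∀ V ∈ finiteRankOperators 𝕜 X, ∃ y ∈ closedCircledHull 𝕜 w.x, c ≤ ‖y - V y‖)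
    {a : ι → 𝕜} {D V : w.Space →L[𝕜] w.Space}
    (hD : HasSum (fun i => a i • w.transfer (hJ i)) D) (i : ι)
    (hV : V ∈ finiteRankOperators 𝕜 w.Space) : c * ‖a i‖ ≤ ‖D - V‖ := by
  refine mul_norm_le_norm_sub_of_comp_eq_smul ?_ w.norm_spread_le
    (fun W _ => w.le_norm_val_sub (I i).left_pos hc W)
    (w.val_integral_comp_spread_of_hasSum hI hJ hD i) hV
  refine ContinuousLinearMap.opNorm_le_bound _ zero_le_one fun z => ?_
  rw [one_mul]
  exact (w.norm_val_disc_le _).trans (w.norm_integral_le z)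

end Transfer

end WillisSequence

namespace UnitSubinterval

/-- The interval `(1 / (n + 4), 1 / (n + 3))`. -/
noncomputable def block (n : ℕ) : UnitSubinterval where
  left := ((n + 1 : ℕ) + 3 : ℝ)⁻¹
  right := (n + 3 : ℝ)⁻¹
  left_pos := by positivity
  left_lt_right := by gcongr; exact n.lt_succ_self
  right_lt_one := inv_lt_one_of_one_lt₀ (by linarith [n.cast_nonneg (α := ℝ)])

/-- The interval `(1 / 2, 3 / 4)`. -/
noncomputable def target : UnitSubinterval where
  left := 1 / 2
  right := 3 / 4
  left_pos := by norm_num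
  left_lt_right := by norm_num
  right_lt_one := by norm_num

theorem pairwise_disjoint_block : Pairwise fun m n => Disjoint (block m).toSet (block n).toSet := by
  have hanti : Antitone fun n : ℕ => (n + 3 : ℝ)⁻¹ := fun m n hmn => by
    dsimp only
    gcongr
  exact hanti.pairwise_disjoint_on_Ioo_succ

theorem block_right_lt_target_left (n : ℕ) : (block n).right < target.left := by
  change (n + 3 : ℝ)⁻¹ < 1 / 2
  rw [one_div]
  gcongr
  linarith [n.cast_nonneg (α := ℝ)]

end UnitSubinterval

theorem WillisSequence.exists_embedding {𝕜 X : Type*} [RCLike 𝕜] [NormedAddCommGroup X]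
    [NormedSpace 𝕜 X] [NormedSpace ℝ X] [IsScalarTower ℝ 𝕜 X] [CompleteSpace X]
    (w : WillisSequence 𝕜 X) :
    ∃ ψ : C₀(ℕ, 𝕜) →L[𝕜] CompactByApproximable 𝕜 w.Space,
      ∃ δ : ℝ, 0 < δ ∧ ∀ a : C₀(ℕ, 𝕜), δ * ‖a‖ ≤ ‖ψ a‖ := by
  obtain ⟨c, hc_pos, hc⟩ := w.fails
  have hlt := UnitSubinterval.block_right_lt_target_left
  have hdisj := UnitSubinterval.pairwise_disjoint_block
  exact exists_embedding_of_le_norm_sub (fun n => w.isCompactOperator_transfer (hlt n)) one_pos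
    (fun S a C hC ha => (w.norm_sum_smul_transfer_le hdisj hlt S a hC ha).trans_eq (one_mul C).symm)
    hc_pos fun a D hD n V hV => w.mul_norm_le_norm_sub_of_hasSum hdisj hlt hc hD n hV

theorem theorem3p3 {𝕜 X : Type*} [RCLike 𝕜] [NormedAddCommGroup X] [NormedSpace 𝕜 X]
    [NormedSpace ℝ X] [IsScalarTower ℝ 𝕜 X] [CompleteSpace X]
    (hX : ¬ HasApproximationProperty 𝕜 X) :
    Nonempty (WillisSequence 𝕜 X) ∧
    ∀ w : WillisSequence 𝕜 X,
      ∃ ψ : C₀(ℕ, 𝕜) →L[𝕜] CompactByApproximable 𝕜 w.Space,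
        ∃ δ : ℝ, 0 < δ ∧ ∀ a : C₀(ℕ, 𝕜), δ * ‖a‖ ≤ ‖ψ a‖ :=
  ⟨nonempty_willisSequence hX, fun w => w.exists_embedding⟩
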